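/- Let $\nu,\mu>0$ and let $X_1,X_2,\dots$ be i.i.d. with the negative binomial law $\mathrm{NB}(\nu,\pi)$, $\pi=\frac{\nu}{\nu+\mu}$, i.e. $\mathbb P(X=x)=\binom{\nu+x-1}{x}(1-\pi)^x\pi^\nu$ for $x\in\mathbb N_0$; its mean is $\mu$, and $\sigma^2$ denotes its variance. Let $f:\mathbb N_0\to\mathbb R$ be such that $f(X+1)$, $Xf(X)$ and $Xf(X+1)$ have finite second moments, put $\tilde\mu_f(k,l,m)=\mathbb E[X^k f(X)^l f(X+1)^m]$, abbreviated $\tilde\mu_{klm}$, and suppose that $\eta_1:=\tilde\mu_{110}-\mu\,\tilde\mu_{001}\neq 0$. Write $\overline{h(X)}=\frac1n\sum_{i=1}^n h(X_i)$, $\Delta f(x)=f(x+1)-f(x)$, and $$\hat\nu_{f,\mathrm{NB}}=\frac{\overline X\;\overline{X\Delta f(X)}}{\overline{Xf(X)}-\overline X\;\overline{f(X+1)}} .$$ Put $g(x_1,x_2,x_3,x_4)=x_1(x_4-x_3)/(x_3-x_1x_2)$, $\mu_Z=(\mu,\tilde\mu_{001},\tilde\mu_{110},\tilde\mu_{101})$,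 $\overline Z=(\overline X,\overline{f(X+1)},\overline{Xf(X)},\overline{Xf(X+1)})$, so that $\hat\nu_{f,\mathrm{NB}}=g(\overline Z)$. Let $D$ and $H$ be the gradient and the Hessian matrix of $g$ at $\mu_Z$, and let $T_n=D(\overline Z-\mu_Z)+\frac12(\overline Z-\mu_Z)^\top H(\overline Z-\mu_Z)$ be the second-order Taylor approximation of $\hat\nu_{f,\mathrm{NB}}-\nu$. Then $\hat\nu_{f,\mathrm{NB}}$ is asymptotically normal, $$\sqrt n\,(\hat\nu_{f,\mathrm{NB}}-\nu)\xrightarrow{\ d\ }\mathrm N\big(0,\;n\,\sigma^2_{f,\mathrm{NB}}\big)\qquad(n\to\infty),$$ where $n\,\sigma^2_{f,\mathrm{NB}}\ge0$ does not depend on $n$, with asymptotic variance $$\begin{aligned} \sigma_{f,\mathrm{NB}}^2=\frac{1}{\eta_1^4 n}\Big[&\mu^4\Big(\tilde\mu_{001}\big(\tilde\mu_{001}(\tilde\mu_{202}-2\tilde\mu_{211}+\tilde\mu_{220})-2(\tilde\mu_{101}-\tilde\mu_{110})(\tilde\mu_{102}-\tilde\mu_{111})\big)+\tilde\mu_{002}(\tilde\mu_{101}-\tilde\mu_{110})^2\Big)\\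 &+2\mu^3\Big(\tilde\mu_{001}\tilde\mu_{101}(\tilde\mu_{211}-\tilde\mu_{220})-\tilde\mu_{110}\big(\tilde\mu_{001}(\tilde\mu_{202}-\tilde\mu_{211})+\tilde\mu_{102}\tilde\mu_{110}\big)\\ &\qquad-\tilde\mu_{101}^2\tilde\mu_{111}+\tilde\mu_{101}\tilde\mu_{110}(\tilde\mu_{102}+\tilde\mu_{111})\Big)\\ &+\mu^2\Big(\tilde\mu_{110}\big(2\tilde\mu_{101}(-\tilde\mu_{001}\tilde\mu_{201}+\tilde\mu_{001}\tilde\mu_{210}+\tilde\mu_{110}^2-\tilde\mu_{211})\\ &\qquad+\tilde\mu_{110}(2\tilde\mu_{001}\tilde\mu_{201}-2\tilde\mu_{001}\tilde\mu_{210}+\tilde\mu_{202})+2\tilde\mu_{101}^3-4\tilde\mu_{101}^2\tilde\mu_{110}\big)+\tilde\mu_{101}^2\tilde\mu_{220}\Big)\\ &-2\mu\,\tilde\mu_{110}(\tilde\mu_{101}-\tilde\mu_{110})(\tilde\mu_{101}\tilde\mu_{210}-\tilde\mu_{110}\tilde\mu_{201})+\tilde\mu_{110}^2\sigma^2(\tilde\mu_{101}-\tilde\mu_{110})^2\Big].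 \end{aligned}$$ Moreover $n\,(\hat\nu_{f,\mathrm{NB}}-\nu-T_n)\to0$ in probability, and for every $n\ge1$ the asymptotic bias $\mathbb B_{f,\mathrm{NB}}:=\mathbb E[T_n]$ exists and equals $$\begin{aligned} \mathbb B_{f,\mathrm{NB}}=-\frac{1}{\eta_1^3 n}\Big[&\mu^3\big(\tilde\mu_{001}(\tilde\mu_{102}-\tilde\mu_{111})+\tilde\mu_{002}(\tilde\mu_{110}-\tilde\mu_{101})\big)\\ &-\mu^2\big(\tilde\mu_{001}(\tilde\mu_{211}-\tilde\mu_{220})-2\tilde\mu_{101}\tilde\mu_{111}+\tilde\mu_{110}(\tilde\mu_{102}+\tilde\mu_{111})\big)\\ &+\mu\big(\tilde\mu_{101}(\tilde\mu_{001}\tilde\mu_{210}+2\tilde\mu_{110}^2-\tilde\mu_{220})+\tilde\mu_{110}(\tilde\mu_{001}\tilde\mu_{201}-2\tilde\mu_{001}\tilde\mu_{210}+\tilde\mu_{211})-2\tilde\mu_{101}^2\tilde\mu_{110}\big)\\ &+\tilde\mu_{110}\big(\tilde\mu_{001}\sigma^2(\tilde\mu_{110}-\tilde\mu_{101})+\tilde\mu_{101}\tilde\mu_{210}-\tilde\mu_{110}\tilde\mu_{201}\big)\Big].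 \end{aligned}$$ -/

import Mathlib

open MeasureTheory ProbabilityTheory Filter Topology

namespace SteinNB

/-- The negative binomial law `NB(ν, p)` on `ℕ`, with probability mass function
`x ↦ binom(ν + x - 1, x) (1 - p)^x p^ν` (generalized binomial coefficient). -/
noncomputable def nbMeasure (ν p : ℝ) : Measure ℕ :=
  Measure.sum fun x : ℕ =>
    ENNReal.ofReal (Ring.choose (ν + (x : ℝ) - 1) x * (1 - p) ^ x * p ^ ν) • Measure.dirac x

/-- The negative binomial law in the `(μ, ν)`-parametrization, `NB(ν, ν / (ν + μ))`. -/
noncomputable def nbLaw (ν μ : ℝ) : Measure ℕ := nbMeasure ν (ν / (ν + μ))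

/-- The mixed moment `E[X^k f(X)^l f(X+1)^m]` for `X ∼ NB(ν, ν / (ν + μ))`. -/
noncomputable def mom (ν μ : ℝ) (f : ℕ → ℝ) (k l m : ℕ) : ℝ :=
  ∫ x : ℕ, (x : ℝ) ^ k * f x ^ l * f (x + 1) ^ m ∂(nbLaw ν μ)

/-- The variance `σ² = V[X]` for `X ∼ NB(ν, ν / (ν + μ))`. -/
noncomputable def sigmaSq (ν μ : ℝ) : ℝ := variance (fun x : ℕ => (x : ℝ)) (nbLaw ν μ)

/-- `η₁ = μ̃_f(1,1,0) - μ μ̃_f(0,0,1)`. -/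
noncomputable def eta (ν μ : ℝ) (f : ℕ → ℝ) : ℝ := mom ν μ f 1 1 0 - μ * mom ν μ f 0 0 1

/-- The sample mean of `h(x₀), …, h(x_{n-1})`. -/
noncomputable def sampleMean (n : ℕ) (x : ℕ → ℕ) (h : ℕ → ℝ) : ℝ :=
  (n : ℝ)⁻¹ * ∑ i ∈ Finset.range n, h (x i)

/-- The Stein-MM estimator of `ν` computed from the sample `x₀, …, x_{n-1}`. -/
noncomputable def steinEstimator (f : ℕ → ℝ) (n : ℕ) (x : ℕ → ℕ) : ℝ :=
  (sampleMean n x (fun y => (y : ℝ)) * sampleMean n x (fun y => (y : ℝ) * (f (y + 1) - f y))) /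
    (sampleMean n x (fun y => (y : ℝ) * f y) -
      sampleMean n x (fun y => (y : ℝ)) * sampleMean n x (fun y => f (y + 1)))

/-- The function `g(x₁,x₂,x₃,x₄) = x₁ (x₄ - x₃) / (x₃ - x₁ x₂)`, which expresses the estimator
through the sample mean of the vectors `(X, f(X+1), X f(X), X f(X+1))`. -/
noncomputable def gNu (z : Fin 4 → ℝ) : ℝ := z 0 * (z 3 - z 2) / (z 2 - z 0 * z 1)

/-- The vector of sample means of `(X, f(X+1), X f(X), X f(X+1))`. -/
noncomputable def zBar (f : ℕ → ℝ) (n : ℕ) (x : ℕ → ℕ) : Fin 4 → ℝ :=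
  ![sampleMean n x (fun y => (y : ℝ)), sampleMean n x (fun y => f (y + 1)),
    sampleMean n x (fun y => (y : ℝ) * f y), sampleMean n x (fun y => (y : ℝ) * f (y + 1))]

/-- The population mean `(μ, μ̃_f(0,0,1), μ̃_f(1,1,0), μ̃_f(1,0,1))` of the same vector. -/
noncomputable def zMean (ν μ : ℝ) (f : ℕ → ℝ) : Fin 4 → ℝ :=
  ![μ, mom ν μ f 0 0 1, mom ν μ f 1 1 0, mom ν μ f 1 0 1]

/-- First- plus second-order terms of the Taylor expansion of `g` at `a`, evaluated at `z`:
`D (z - a) + ½ (z - a)ᵀ H (z - a)` with `D` the gradient and `H` the Hessian of `g` at `a`. -/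
noncomputable def taylorTwo (g : (Fin 4 → ℝ) → ℝ) (a z : Fin 4 → ℝ) : ℝ :=
  fderiv ℝ g a (z - a) + 1 / 2 * fderiv ℝ (fderiv ℝ g) a (z - a) (z - a)

/-- The asymptotic variance of the estimator for sample size `n`. -/
noncomputable def asympVar (ν μ : ℝ) (f : ℕ → ℝ) (n : ℕ) : ℝ :=
  let m : ℕ → ℕ → ℕ → ℝ := mom ν μ f;
  1 / (eta ν μ f ^ 4 * n) *
    (μ ^ 4 * (m 0 0 1 * (m 0 0 1 * (m 2 0 2 - 2 * m 2 1 1 + m 2 2 0)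
          - 2 * (m 1 0 1 - m 1 1 0) * (m 1 0 2 - m 1 1 1))
        + m 0 0 2 * (m 1 0 1 - m 1 1 0) ^ 2)
      + 2 * μ ^ 3 * (m 0 0 1 * m 1 0 1 * (m 2 1 1 - m 2 2 0)
        - m 1 1 0 * (m 0 0 1 * (m 2 0 2 - m 2 1 1) + m 1 0 2 * m 1 1 0)
        - m 1 0 1 ^ 2 * m 1 1 1 + m 1 0 1 * m 1 1 0 * (m 1 0 2 + m 1 1 1))
      + μ ^ 2 * (m 1 1 0 * (2 * m 1 0 1 * (-(m 0 0 1 * m 2 0 1) + m 0 0 1 * m 2 1 0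
              + m 1 1 0 ^ 2 - m 2 1 1)
            + m 1 1 0 * (2 * m 0 0 1 * m 2 0 1 - 2 * m 0 0 1 * m 2 1 0 + m 2 0 2)
            + 2 * m 1 0 1 ^ 3 - 4 * m 1 0 1 ^ 2 * m 1 1 0)
          + m 1 0 1 ^ 2 * m 2 2 0)
      - 2 * μ * m 1 1 0 * (m 1 0 1 - m 1 1 0) * (m 1 0 1 * m 2 1 0 - m 1 1 0 * m 2 0 1)
      + m 1 1 0 ^ 2 * sigmaSq ν μ * (m 1 0 1 - m 1 1 0) ^ 2)

/-- The asymptotic bias of the estimator for sample size `n`. -/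
noncomputable def asympBias (ν μ : ℝ) (f : ℕ → ℝ) (n : ℕ) : ℝ :=
  let m : ℕ → ℕ → ℕ → ℝ := mom ν μ f;
  -(1 / (eta ν μ f ^ 3 * n)) *
    (μ ^ 3 * (m 0 0 1 * (m 1 0 2 - m 1 1 1) + m 0 0 2 * (m 1 1 0 - m 1 0 1))
      - μ ^ 2 * (m 0 0 1 * (m 2 1 1 - m 2 2 0) - 2 * m 1 0 1 * m 1 1 1
        + m 1 1 0 * (m 1 0 2 + m 1 1 1))
      + μ * (m 1 0 1 * (m 0 0 1 * m 2 1 0 + 2 * m 1 1 0 ^ 2 - m 2 2 0)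
        + m 1 1 0 * (m 0 0 1 * m 2 0 1 - 2 * m 0 0 1 * m 2 1 0 + m 2 1 1)
        - 2 * m 1 0 1 ^ 2 * m 1 1 0)
      + m 1 1 0 * (m 0 0 1 * sigmaSq ν μ * (m 1 1 0 - m 1 0 1)
        + m 1 0 1 * m 2 1 0 - m 1 1 0 * m 2 0 1))

end SteinNB

/-! The estimator is `g` at a vector of sample means, so this is a second-order delta method. Three
ingredients carry it.

Stein identity: the weights satisfy `(x+1) w(x+1) = (1-p)(ν+x) w(x)`, and an index shift gives
`(ν+μ) E[X h(X)] = μ (ν E[h(X+1)] + E[X h(X+1)])`. For `h = 1` this yields the mean; for `h = f`,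
solved for `ν`, it says `g(μ_Z) = ν` (`gNu_zMean`).

Expansion of `g`: its denominator at `μ_Z` is `η₁ ≠ 0`, so `g` is smooth there, with linear part
`gLin`, quadratic part `gQuad` and an explicit cubic remainder (`gNu_add_sub`).

Remainders: the covariances of `Z̄` are those of one observation divided by `n`, so `√n ‖Z̄ - μ_Z‖`
is bounded in `L²`, and a remainder `o(‖h‖^k)` vanishes in probability after scaling by `√n ^ k`.
The case `k = 1` reduces normality to the scalar central limit theorem for `gLin`; `k = 2` gives the
Taylor claim. The bias is the mean of `gQuad`, since `gLin` of the error is centred. The stated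
formulas then follow by polynomial algebra. -/

namespace SteinNB

/-! ### Negative binomial weights and their recursion -/

/-- The probability mass function of the negative binomial law. -/
noncomputable def nbWeight (ν p : ℝ) (x : ℕ) : ℝ :=
  Ring.choose (ν + (x : ℝ) - 1) x * (1 - p) ^ x * p ^ ν

/-- Positivity and the recursion of the generalized binomial coefficients are both read off from the
rising factorial `ν (ν+1) ⋯ (ν+x-1)`. -/
lemma factorial_mul_choose (ν : ℝ) (x : ℕ) :
    (x.factorial : ℝ) * Ring.choose (ν + (x : ℝ) - 1) x = (ascPochhammer ℝ x).eval ν := by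
  rw [← Ring.multichoose_eq, ← nsmul_eq_mul, Ring.factorial_nsmul_multichoose_eq_ascPochhammer,
    Polynomial.ascPochhammer_smeval_eq_eval]

lemma choose_succ_mul (ν : ℝ) (x : ℕ) :
    ((x : ℝ) + 1) * Ring.choose (ν + ((x + 1 : ℕ) : ℝ) - 1) (x + 1) =
      (ν + x) * Ring.choose (ν + (x : ℝ) - 1) x := by
  have h0 := factorial_mul_choose ν x
  have h1 := factorial_mul_choose ν (x + 1)
  rw [ascPochhammer_succ_eval, ← h0, Nat.factorial_succ, Nat.cast_mul] at h1
  have hx : (x.factorial : ℝ) ≠ 0 := by positivity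
  apply mul_left_cancel₀ hx
  push_cast at h1 ⊢
  linarith

lemma choose_pos {ν : ℝ} (hν : 0 < ν) (x : ℕ) : 0 < Ring.choose (ν + (x : ℝ) - 1) x := by
  have h := ascPochhammer_pos x ν hν
  rw [← factorial_mul_choose] at h
  exact pos_of_mul_pos_right h (by positivity)

lemma nbWeight_pos {ν p : ℝ} (hν : 0 < ν) (hp : 0 < p) (hp1 : p < 1) (x : ℕ) :
    0 < nbWeight ν p x :=
  mul_pos (mul_pos (choose_pos hν x) (pow_pos (by linarith) _)) (Real.rpow_pos_of_pos hp _)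

lemma succ_mul_nbWeight_succ (ν p : ℝ) (x : ℕ) :
    ((x : ℝ) + 1) * nbWeight ν p (x + 1) = (1 - p) * (ν + x) * nbWeight ν p x := by
  have h := choose_succ_mul ν x
  unfold nbWeight
  rw [pow_succ]
  linear_combination (1 - p) ^ x * (1 - p) * p ^ ν * h

/-! ### Second moment, Stein identity and mean of the law -/

section Law

variable {ν μ : ℝ}

lemma one_sub_successProb (hν : 0 < ν) (hμ : 0 < μ) : 1 - ν / (ν + μ) = μ / (ν + μ) := by
  field_simp
  ring

lemma nbWeight_pos' (hν : 0 < ν) (hμ : 0 < μ) (x : ℕ) : 0 < nbWeight ν (ν / (ν + μ)) x :=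
  nbWeight_pos hν (by positivity) (by rw [div_lt_one (by positivity)]; linarith) x

lemma integrable_nbLaw_iff (hν : 0 < ν) (hμ : 0 < μ) {h : ℕ → ℝ} :
    Integrable h (nbLaw ν μ) ↔ Summable fun x => nbWeight ν (ν / (ν + μ)) x * |h x| := by
  unfold nbLaw nbMeasure
  rw [integrable_sum_dirac_iff (by simp)]
  refine summable_congr fun x => ?_
  change (ENNReal.ofReal (nbWeight ν (ν / (ν + μ)) x)).toReal * _ = _
  rw [ENNReal.toReal_ofReal (nbWeight_pos' hν hμ x).le, Real.norm_eq_abs]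

lemma integral_nbLaw (hν : 0 < ν) (hμ : 0 < μ) (h : ℕ → ℝ) :
    ∫ x, h x ∂nbLaw ν μ = ∑' x, nbWeight ν (ν / (ν + μ)) x * h x := by
  unfold nbLaw nbMeasure
  rw [integral_sum_dirac (by simp)]
  refine tsum_congr fun x => ?_
  change (ENNReal.ofReal (nbWeight ν (ν / (ν + μ)) x)).toReal • _ = _
  rw [ENNReal.toReal_ofReal (nbWeight_pos' hν hμ x).le, smul_eq_mul]

lemma summable_nbWeight_mul (hν : 0 < ν) (hμ : 0 < μ) {h : ℕ → ℝ}
    (hh : Integrable h (nbLaw ν μ)) : Summable fun x => nbWeight ν (ν / (ν + μ)) x * h x := by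
  refine Summable.of_norm ?_
  refine ((integrable_nbLaw_iff hν hμ).1 hh).congr fun x => ?_
  rw [Real.norm_eq_abs, abs_mul, abs_of_pos (nbWeight_pos' hν hμ x)]

lemma integrable_natCast_sq_nbLaw (hν : 0 < ν) (hμ : 0 < μ) :
    Integrable (fun x : ℕ => (x : ℝ) ^ 2) (nbLaw ν μ) := by
  rw [integrable_nbLaw_iff hν hμ]
  set p := ν / (ν + μ) with hp
  have hp1 : 1 - p < 1 := by
    have : 0 < p := by positivity
    linarith
  have hw : ∀ x, 0 < nbWeight ν p x := nbWeight_pos' hν hμ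
  refine summable_of_ratio_test_tendsto_lt_one hp1 ?_
    (f := fun x : ℕ => nbWeight ν p x * |(x : ℝ) ^ 2|) ?_
  · filter_upwards [eventually_gt_atTop 0] with x hx
    have := hw x
    positivity
  -- By the recursion, the ratio of consecutive terms is `(1-p)(ν+x)(x+1)/x² = (1-p)(1+ν/x)(1+1/x)`.
  · have hlim : Tendsto (fun x : ℕ => (1 - p) * ((1 + ν * (x : ℝ)⁻¹) * (1 + (x : ℝ)⁻¹))) atTop
        (𝓝 ((1 - p) * ((1 + ν * 0) * (1 + 0)))) := by
      have hi : Tendsto (fun x : ℕ => (x : ℝ)⁻¹) atTop (𝓝 0) := tendsto_inv_atTop_nhds_zero_nat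
      exact ((tendsto_const_nhds.add (hi.const_mul ν)).mul (tendsto_const_nhds.add hi)).const_mul _
    simp only [mul_zero, add_zero, mul_one] at hlim
    refine hlim.congr' ?_
    filter_upwards [eventually_gt_atTop 0] with x hx
    have hx' : (0 : ℝ) < x := by exact_mod_cast hx
    have h0 := hw x
    have h1 := hw (x + 1)
    have hs := succ_mul_nbWeight_succ ν p x
    have hs' : nbWeight ν p (x + 1) = (1 - p) * (ν + x) * nbWeight ν p x / ((x : ℝ) + 1) := by
      rw [← hs]; field_simp
    rw [Real.norm_of_nonneg (by positivity), Real.norm_of_nonneg (by positivity),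
      abs_of_nonneg (by positivity), abs_of_nonneg (by positivity), hs']
    push_cast
    field_simp
    ring

/-- The Stein identity of the negative binomial law. -/
lemma stein_identity (hν : 0 < ν) (hμ : 0 < μ) {h : ℕ → ℝ}
    (h1 : Integrable (fun x => h (x + 1)) (nbLaw ν μ))
    (h2 : Integrable (fun x : ℕ => (x : ℝ) * h x) (nbLaw ν μ))
    (h3 : Integrable (fun x : ℕ => (x : ℝ) * h (x + 1)) (nbLaw ν μ)) :
    (ν + μ) * ∫ x : ℕ, (x : ℝ) * h x ∂nbLaw ν μ =
      μ * (ν * ∫ x, h (x + 1) ∂nbLaw ν μ + ∫ x : ℕ, (x : ℝ) * h (x + 1) ∂nbLaw ν μ) := by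
  have s1 := summable_nbWeight_mul hν hμ h1
  have s2 := summable_nbWeight_mul hν hμ h2
  have s3 := summable_nbWeight_mul hν hμ h3
  -- The factor `x` kills the term at `0`, so the left sum can be shifted by one and compared
  -- termwise through the recursion.
  rw [integral_nbLaw hν hμ, integral_nbLaw hν hμ, integral_nbLaw hν hμ, s2.tsum_eq_zero_add]
  simp only [Nat.cast_zero, zero_mul, mul_zero, zero_add, Nat.cast_add, Nat.cast_one]
  rw [← tsum_mul_left, ← tsum_mul_left, ← (s1.mul_left ν).tsum_add s3, ← tsum_mul_left]
  refine tsum_congr fun x => ?_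
  have hs := succ_mul_nbWeight_succ ν (ν / (ν + μ)) x
  rw [one_sub_successProb hν hμ] at hs
  have hne : ν + μ ≠ 0 := by positivity
  field_simp at hs
  linear_combination h (x + 1) * hs

lemma memLp_natCast_nbLaw (hν : 0 < ν) (hμ : 0 < μ) :
    MemLp (fun x : ℕ => (x : ℝ)) 2 (nbLaw ν μ) :=
  (memLp_two_iff_integrable_sq (by fun_prop)).2 (integrable_natCast_sq_nbLaw hν hμ)

/-- The mean of the negative binomial law. -/
lemma integral_natCast_nbLaw [IsProbabilityMeasure (nbLaw ν μ)] (hν : 0 < ν) (hμ : 0 < μ) :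
    ∫ x : ℕ, (x : ℝ) ∂nbLaw ν μ = μ := by
  have hi : Integrable (fun x : ℕ => (x : ℝ)) (nbLaw ν μ) :=
    (memLp_natCast_nbLaw hν hμ).integrable (by norm_num)
  -- For `h = 1` the identity reads `(ν+μ) E[X] = μ (ν + E[X])`.
  have h := stein_identity hν hμ (h := fun _ => 1) (by simp) (by simpa using hi)
    (by simpa using hi)
  simp only [mul_one, integral_const, probReal_univ, smul_eq_mul] at h
  apply mul_left_cancel₀ hν.ne'
  linarith

end Law

/-! ### Negligible remainders in the delta method -/

/-- If `√n ‖W n‖` is bounded in `L²` and `r h = o(‖h‖ ^ k)` at `0`, then `√n ^ k * r (W n)` tends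
to `0` in probability. -/
lemma tendstoInMeasure_sqrt_pow_mul_of_isLittleO {Ω E : Type*} [MeasurableSpace Ω]
    {P : Measure Ω} [IsProbabilityMeasure P] [NormedAddCommGroup E] {W : ℕ → Ω → E} {C : ℝ}
    (hint : ∀ n, Integrable (fun ω => ‖W n ω‖ ^ 2) P)
    (hC : ∀ n : ℕ, (n : ℝ) * ∫ ω, ‖W n ω‖ ^ 2 ∂P ≤ C) {r : E → ℝ} {k : ℕ}
    (hr : r =o[𝓝 0] fun h => ‖h‖ ^ k) :
    TendstoInMeasure P (fun (n : ℕ) ω => √n ^ k * r (W n ω)) atTop fun _ => 0 := by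
  rw [tendstoInMeasure_iff_measureReal_norm]
  intro ε hε
  have hC0 : 0 ≤ C := by simpa using hC 0
  -- Chebyshev's bound, uniform in `n`: the rescaled errors are tight.
  have hcheb : ∀ (n : ℕ) (M : ℝ), 0 < M → P.real {ω | M ≤ √n * ‖W n ω‖} ≤ C / M ^ 2 := by
    intro n M hM
    rw [le_div_iff₀ (by positivity), mul_comm]
    have h1 := mul_meas_ge_le_integral_of_nonneg (μ := P)
      (f := fun ω => (n : ℝ) * ‖W n ω‖ ^ 2) (.of_forall fun ω => by positivity)
      ((hint n).const_mul _) (M ^ 2)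
    rw [integral_const_mul] at h1
    refine le_trans ?_ (h1.trans (hC n))
    refine mul_le_mul_of_nonneg_left (measureReal_mono fun ω hω => ?_) (by positivity)
    have h2 := pow_le_pow_left₀ hM.le hω 2
    rwa [mul_pow, Real.sq_sqrt (by positivity)] at h2
  refine tendsto_order.2 ⟨fun b hb => .of_forall fun n => hb.trans_le measureReal_nonneg,
    fun δ hδ => ?_⟩
  obtain ⟨M, hM, hMδ⟩ : ∃ M : ℝ, 0 < M ∧ C / M ^ 2 < δ := by
    have hlim : Tendsto (fun M : ℝ => C / M ^ 2) atTop (𝓝 0) :=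
      tendsto_const_nhds.div_atTop (tendsto_pow_atTop (by norm_num))
    exact ((eventually_gt_atTop 0).and (hlim.eventually_lt_const hδ)).exists
  have hMk : 0 < M ^ k := by positivity
  -- With this constant, `√n ^ k |r (W n)| ≤ ε/2` wherever `√n ‖W n‖ < M` and `‖W n‖ < ρ`; the
  -- second condition follows from the first once `√n ≥ M/ρ`.
  have hc : 0 < ε / (2 * M ^ k) := by positivity
  obtain ⟨ρ, hρ, hball⟩ := Metric.eventually_nhds_iff.1 (hr.def hc)
  have hbig : Tendsto (fun n : ℕ => √(n : ℝ)) atTop atTop :=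
    Real.tendsto_sqrt_atTop.comp tendsto_natCast_atTop_atTop
  filter_upwards [hbig.eventually_ge_atTop (M / ρ)] with n hn
  refine lt_of_le_of_lt (measureReal_mono fun ω hω => ?_) ((hcheb n M hM).trans_lt hMδ)
  by_contra hlt
  simp only [Set.mem_ofPred_eq, not_le, sub_zero, Real.norm_eq_abs] at hω hlt
  have hW : ‖W n ω‖ < ρ := by
    by_contra! hge
    have := mul_le_mul hn hge hρ.le (by positivity)
    rw [div_mul_cancel₀ _ hρ.ne'] at this
    linarith
  have hrW := hball (y := W n ω) (by simpa using hW)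
  rw [Real.norm_eq_abs, Real.norm_of_nonneg (by positivity)] at hrW
  rw [abs_mul, abs_of_nonneg (by positivity)] at hω
  have h1 : (√(n : ℝ) * ‖W n ω‖) ^ k ≤ M ^ k := pow_le_pow_left₀ (by positivity) hlt.le k
  have h2 : √(n : ℝ) ^ k * |r (W n ω)| ≤ ε / (2 * M ^ k) * M ^ k := by
    calc √(n : ℝ) ^ k * |r (W n ω)|
        ≤ √(n : ℝ) ^ k * (ε / (2 * M ^ k) * ‖W n ω‖ ^ k) := by gcongr
      _ = ε / (2 * M ^ k) * (√(n : ℝ) * ‖W n ω‖) ^ k := by rw [mul_pow]; ring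
      _ ≤ _ := by gcongr
  have h3 : ε / (2 * M ^ k) * M ^ k = ε / 2 := by field_simp
  linarith

/-! ### Moments and central limit theorem for sample means -/

section IID

variable {Ω : Type*} [MeasurableSpace Ω] {P : Measure Ω}
  {L : Measure ℕ} {X : ℕ → Ω → ℕ} {φ ψ : ℕ → ℝ}

lemma memLp_comp_hasLaw (hlaw : ∀ i, HasLaw (X i) L P) (hφ : MemLp φ 2 L) (i : ℕ) :
    MemLp (fun ω => φ (X i ω)) 2 P := by
  rw [← (hlaw i).map_eq] at hφ
  exact (memLp_map_measure_iff hφ.1 (hlaw i).aemeasurable).1 hφ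

lemma memLp_sampleMean (hlaw : ∀ i, HasLaw (X i) L P) (hφ : MemLp φ 2 L) (n : ℕ) :
    MemLp (fun ω => sampleMean n (fun i => X i ω) φ) 2 P := by
  unfold sampleMean
  exact (memLp_finsetSum _ fun i _ => memLp_comp_hasLaw hlaw hφ i).const_mul _

variable [IsProbabilityMeasure P]

lemma integral_sampleMean (hlaw : ∀ i, HasLaw (X i) L P) (hφ : MemLp φ 2 L) {n : ℕ}
    (hn : 1 ≤ n) : ∫ ω, sampleMean n (fun i => X i ω) φ ∂P = ∫ x, φ x ∂L := by
  unfold sampleMean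
  rw [integral_const_mul, integral_finsetSum _ fun i _ =>
    (memLp_comp_hasLaw hlaw hφ i).integrable (by norm_num)]
  have : ∀ i, ∫ ω, φ (X i ω) ∂P = ∫ x, φ x ∂L := fun i => (hlaw i).integral_comp hφ.1
  have hn' : (n : ℝ) ≠ 0 := by positivity
  simp [this, hn']

/-- Independence removes the off-diagonal terms of the double sum, leaving `n` equal terms with the
factor `1/n²`. -/
lemma covariance_sampleMean (hlaw : ∀ i, HasLaw (X i) L P) (hindep : iIndepFun X P)
    (hφ : MemLp φ 2 L) (hψ : MemLp ψ 2 L) (n : ℕ) :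
    covariance (fun ω => sampleMean n (fun i => X i ω) φ)
      (fun ω => sampleMean n (fun i => X i ω) ψ) P = covariance φ ψ L / n := by
  unfold sampleMean
  rw [covariance_const_mul_left, covariance_const_mul_right, covariance_fun_sum_fun_sum'
    (fun i _ => memLp_comp_hasLaw hlaw hφ i) (fun i _ => memLp_comp_hasLaw hlaw hψ i)]
  have hd : ∀ i, covariance (fun ω => φ (X i ω)) (fun ω => ψ (X i ω)) P = covariance φ ψ L := by
    intro i
    rw [← (hlaw i).map_eq, covariance_map_fun (by fun_prop) (by fun_prop) (hlaw i).aemeasurable]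
  have ho : ∀ i j, j ≠ i → covariance (fun ω => φ (X i ω)) (fun ω => ψ (X j ω)) P = 0 := by
    intro i j hij
    exact IndepFun.covariance_eq_zero
      ((hindep.indepFun hij.symm).comp (φ := φ) (ψ := ψ) (by fun_prop) (by fun_prop))
      (memLp_comp_hasLaw hlaw hφ i) (memLp_comp_hasLaw hlaw hψ j)
  have hs : ∀ i ∈ Finset.range n, ∑ j ∈ Finset.range n,
      covariance (fun ω => φ (X i ω)) (fun ω => ψ (X j ω)) P = covariance φ ψ L := by
    intro i hi
    rw [Finset.sum_eq_single_of_mem i hi fun j _ hij => ho i j hij, hd]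
  rw [Finset.sum_congr rfl hs, Finset.sum_const, Finset.card_range, nsmul_eq_mul]
  -- For `n = 0` both sides vanish by the convention for division by zero.
  rcases eq_or_ne (n : ℝ) 0 with h0 | h0
  · simp [h0]
  · field_simp

lemma integral_sampleMean_sub_mul_sub (hlaw : ∀ i, HasLaw (X i) L P) (hindep : iIndepFun X P)
    (hφ : MemLp φ 2 L) (hψ : MemLp ψ 2 L) {n : ℕ} (hn : 1 ≤ n) :
    ∫ ω, (sampleMean n (fun i => X i ω) φ - ∫ x, φ x ∂L) *
      (sampleMean n (fun i => X i ω) ψ - ∫ x, ψ x ∂L) ∂P = covariance φ ψ L / n := by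
  rw [← covariance_sampleMean hlaw hindep hφ hψ n, covariance, integral_sampleMean hlaw hφ hn,
    integral_sampleMean hlaw hψ hn]

/-- The central limit theorem for sample means. -/
lemma tendstoInDistribution_sqrt_mul_sampleMean_sub (hlaw : ∀ i, HasLaw (X i) L P)
    (hindep : iIndepFun X P) (hφ : MemLp φ 2 L) :
    TendstoInDistribution
      (fun (n : ℕ) ω => √n * (sampleMean n (fun i => X i ω) φ - ∫ x, φ x ∂L))
      atTop id (fun _ => P) (gaussianReal 0 (covariance φ φ L).toNNReal) := by
  have hE : ∫ ω, φ (X 0 ω) ∂P = ∫ x, φ x ∂L := (hlaw 0).integral_comp hφ.1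
  have hV : variance (fun ω => φ (X 0 ω)) P = covariance φ φ L := by
    rw [← (hlaw 0).map_eq, covariance_map_fun (by fun_prop) (by fun_prop) (hlaw 0).aemeasurable,
      covariance_self (memLp_comp_hasLaw hlaw hφ 0).1.aemeasurable]
  have hclt := tendstoInDistribution_inv_sqrt_mul_sum_sub (P := P)
    (P' := gaussianReal 0 (covariance φ φ L).toNNReal) (X := fun i ω => φ (X i ω)) (Y := id)
    (by rw [hV]; exact HasLaw.id) (memLp_comp_hasLaw hlaw hφ 0)
    (hindep.comp (fun _ => φ) fun _ => by fun_prop)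
    (fun i => IdentDistrib.comp (u := φ)
      ⟨(hlaw i).aemeasurable, (hlaw 0).aemeasurable, by rw [(hlaw i).map_eq, (hlaw 0).map_eq]⟩
      (by fun_prop))
  refine hclt.congr (fun n => .of_forall fun ω => ?_) .rfl
  simp only [hE, sampleMean]
  rcases eq_or_ne n 0 with rfl | hn
  · simp
  · have h1 : (0 : ℝ) < n := by positivity
    have h2 : √(n : ℝ) ≠ 0 := (Real.sqrt_pos.2 h1).ne'
    have h3 : √(n : ℝ) * √(n : ℝ) = n := Real.mul_self_sqrt h1.le
    have h4 : √(n : ℝ) * (n : ℝ)⁻¹ = (√(n : ℝ))⁻¹ := by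
      rw [← div_eq_mul_inv, ← one_div, div_eq_div_iff h1.ne' h2, h3, one_mul]
    have h5 : (√(n : ℝ))⁻¹ * n = √n := by
      rw [← h4, mul_assoc, inv_mul_cancel₀ h1.ne', mul_one]
    rw [mul_sub, mul_sub, ← mul_assoc, ← mul_assoc, h4, h5]

end IID

/-! ### Second-order Taylor expansion of `g` -/

/-- The denominator of `gNu`. -/
noncomputable def gDen (a : Fin 4 → ℝ) : ℝ := a 2 - a 0 * a 1

/-- The derivative of the denominator of `gNu` at `a` in direction `h`. -/
noncomputable def gDenLin (a h : Fin 4 → ℝ) : ℝ := h 2 - h 0 * a 1 - a 0 * h 1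

/-- The first-order term of the Taylor expansion of `gNu` at `a`. -/
noncomputable def gLin (a h : Fin 4 → ℝ) : ℝ :=
  (h 0 * (a 3 - a 2) + a 0 * (h 3 - h 2) - gNu a * gDenLin a h) / gDen a

/-- The second-order term of the Taylor expansion of `gNu` at `a`. -/
noncomputable def gQuad (a h : Fin 4 → ℝ) : ℝ :=
  (h 0 * (h 3 - h 2) + gNu a * (h 0 * h 1) - gLin a h * gDenLin a h) / gDen a

lemma contDiffAt_gNu {a : Fin 4 → ℝ} (ha : gDen a ≠ 0) : ContDiffAt ℝ 2 gNu a := by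
  unfold gNu
  exact ContDiffAt.div (by fun_prop) (by fun_prop) ha

lemma hasDerivAt_coord (a h : Fin 4 → ℝ) (i : Fin 4) :
    HasDerivAt (fun t : ℝ => (a + t • h) i) (h i) 0 := by
  simpa using ((hasDerivAt_id (0 : ℝ)).mul_const (h i)).const_add (a i)

/-- Reduces the gradient and the Hessian form to one-variable derivatives along lines. -/
lemma fderiv_eq_of_hasDerivAt_line {E : Type*} [NormedAddCommGroup E] [NormedSpace ℝ E]
    {F : E → ℝ} {a h : E} {c : ℝ} (hF : DifferentiableAt ℝ F a)
    (hc : HasDerivAt (fun t : ℝ => F (a + t • h)) c 0) : fderiv ℝ F a h = c := by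
  have := hF.hasFDerivAt.hasLineDerivAt h
  exact this.unique hc

lemma hasDerivAt_gNu_line {a : Fin 4 → ℝ} (ha : gDen a ≠ 0) (h : Fin 4 → ℝ) :
    HasDerivAt (fun t : ℝ => gNu (a + t • h)) (gLin a h) 0 := by
  have c := hasDerivAt_coord a h
  have := ((c 0).mul ((c 3).sub (c 2))).div ((c 2).sub ((c 0).mul (c 1))) (by simpa [gDen] using ha)
  refine this.congr_deriv ?_
  simp only [zero_smul, add_zero, Pi.mul_apply, Pi.sub_apply, gLin, gDenLin, gNu]
  unfold gDen at *
  field_simp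
  ring

lemma fderiv_gNu {a : Fin 4 → ℝ} (ha : gDen a ≠ 0) (h : Fin 4 → ℝ) :
    fderiv ℝ gNu a h = gLin a h :=
  fderiv_eq_of_hasDerivAt_line ((contDiffAt_gNu ha).differentiableAt (by simp))
    (hasDerivAt_gNu_line ha h)

lemma hasDerivAt_gLin_line {a : Fin 4 → ℝ} (ha : gDen a ≠ 0) (h : Fin 4 → ℝ) :
    HasDerivAt (fun t : ℝ => gLin (a + t • h) h) (2 * gQuad a h) 0 := by
  have c := hasDerivAt_coord a h
  have k := fun i => hasDerivAt_const (0 : ℝ) (h i)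
  have := ((((k 0).mul ((c 3).sub (c 2))).add ((c 0).mul ((k 3).sub (k 2)))).sub
    ((hasDerivAt_gNu_line ha h).mul
      (((k 2).sub ((k 0).mul (c 1))).sub ((c 0).mul (k 1))))).div
    ((c 2).sub ((c 0).mul (c 1))) (by simpa [gDen] using ha)
  refine this.congr_deriv ?_
  simp only [zero_smul, add_zero, Pi.mul_apply, Pi.sub_apply, Pi.add_apply, Pi.zero_apply, gQuad]
  -- Once `gNu a` and `gLin a h` are treated as atoms, this is the only relation needed: it
  -- eliminates the numerator of `gLin` from the quotient rule.
  have hl : gLin a h * gDen a =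
      h 0 * (a 3 - a 2) + a 0 * (h 3 - h 2) - gNu a * gDenLin a h := by
    unfold gLin; field_simp
  generalize gLin a h = l at *
  generalize gNu a = g at *
  unfold gDen gDenLin at *
  rw [← mul_div_assoc, div_eq_div_iff (pow_ne_zero 2 ha) ha]
  linear_combination (h 2 - h 0 * a 1 - a 0 * h 1) * (a 2 - a 0 * a 1) * hl

lemma fderiv_fderiv_gNu {a : Fin 4 → ℝ} (ha : gDen a ≠ 0) (h : Fin 4 → ℝ) :
    fderiv ℝ (fderiv ℝ gNu) a h h = 2 * gQuad a h := by
  have hd : DifferentiableAt ℝ (fderiv ℝ gNu) a :=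
    ((contDiffAt_gNu ha).fderiv_right (m := 1) (by norm_num)).differentiableAt (by simp)
  have h1 : fderiv ℝ (fun z => fderiv ℝ gNu z h) a h = fderiv ℝ (fderiv ℝ gNu) a h h := by
    rw [fderiv_clm_apply hd (differentiableAt_const h)]
    simp
  rw [← h1]
  refine fderiv_eq_of_hasDerivAt_line (hd.clm_apply (differentiableAt_const h)) ?_
  refine (hasDerivAt_gLin_line ha h).congr_of_eventuallyEq ?_
  have hcont : ContinuousAt (fun t : ℝ => gDen (a + t • h)) 0 := by
    unfold gDen; fun_prop
  -- The denominator stays nonzero near `a`, so the gradient formula holds along the line and can be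
  -- differentiated again.
  filter_upwards [hcont.eventually_ne (by simpa using ha)] with t ht
  exact fderiv_gNu ht h

lemma taylorTwo_gNu {a : Fin 4 → ℝ} (ha : gDen a ≠ 0) (z : Fin 4 → ℝ) :
    taylorTwo gNu a z = gLin a (z - a) + gQuad a (z - a) := by
  unfold taylorTwo
  rw [fderiv_gNu ha, fderiv_fderiv_gNu ha]
  ring

/-- Expand the product of `g` and its denominator, which equals the numerator. `hg`, `hl`, `hq` are
this equation in orders 0, 1 and 2 in `h`; only terms of order three and four survive. -/
lemma gNu_add_sub {a h : Fin 4 → ℝ} (ha : gDen a ≠ 0) (hah : gDen (a + h) ≠ 0) :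
    gNu (a + h) - gNu a - (gLin a h + gQuad a h) =
      (h 0 * h 1 * gLin a h + h 0 * h 1 * gQuad a h - gDenLin a h * gQuad a h) *
        (gDen (a + h))⁻¹ := by
  have hl : gLin a h * gDen a =
      h 0 * (a 3 - a 2) + a 0 * (h 3 - h 2) - gNu a * gDenLin a h := by
    unfold gLin; field_simp
  have hq : gQuad a h * gDen a =
      h 0 * (h 3 - h 2) + gNu a * (h 0 * h 1) - gLin a h * gDenLin a h := by
    unfold gQuad; field_simp
  have hn : gNu (a + h) * gDen (a + h) = (a 0 + h 0) * (a 3 + h 3 - (a 2 + h 2)) := by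
    rw [gNu, ← gDen, div_mul_cancel₀ _ hah]; simp
  have hg : gNu a * gDen a = a 0 * (a 3 - a 2) := by
    rw [gNu, ← gDen, div_mul_cancel₀ _ ha]
  have hd : gDen (a + h) = gDen a + gDenLin a h - h 0 * h 1 := by
    simp only [gDen, gDenLin, Pi.add_apply]; ring
  rw [eq_mul_inv_iff_mul_eq₀ hah]
  rw [sub_mul, sub_mul, hn, hd]
  linear_combination -hl - hq - hg

lemma isBigO_coord (i : Fin 4) : (fun h : Fin 4 → ℝ => h i) =O[𝓝 0] fun h => ‖h‖ :=
  .of_bound 1 (.of_forall fun h => by simpa using norm_le_pi_norm h i)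

/-- The second-order Taylor expansion of `gNu` with Peano remainder. -/
lemma gNu_taylor_isLittleO {a : Fin 4 → ℝ} (ha : gDen a ≠ 0) :
    (fun h => gNu (a + h) - gNu a - (gLin a h + gQuad a h)) =o[𝓝 0] fun h => ‖h‖ ^ 2 := by
  have c := isBigO_coord
  have hq : (fun h => gDenLin a h) =O[𝓝 0] fun h => ‖h‖ := by
    unfold gDenLin
    refine ((c 2).sub ?_).sub ((c 1).const_mul_left (a 0))
    simpa [mul_comm] using (c 0).const_mul_left (a 1)
  have hl : (fun h => gLin a h) =O[𝓝 0] fun h => ‖h‖ := by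
    unfold gLin
    simp only [div_eq_inv_mul]
    refine Asymptotics.IsBigO.const_mul_left ?_ _
    refine (Asymptotics.IsBigO.add ?_ (((c 3).sub (c 2)).const_mul_left _)).sub
      (hq.const_mul_left _)
    simpa [mul_comm] using (c 0).const_mul_left (a 3 - a 2)
  have h01 : (fun h : Fin 4 → ℝ => h 0 * h 1) =O[𝓝 0] fun h => ‖h‖ * ‖h‖ := (c 0).mul (c 1)
  have hQ : (fun h => gQuad a h) =O[𝓝 0] fun h => ‖h‖ * ‖h‖ := by
    unfold gQuad
    simp only [div_eq_inv_mul]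
    refine Asymptotics.IsBigO.const_mul_left ?_ _
    exact (((c 0).mul ((c 3).sub (c 2))).add (h01.const_mul_left _)).sub (hl.mul hq)
  have hcont : ContinuousAt (fun h => gDen (a + h)) 0 := by unfold gDen; fun_prop
  have hne : ∀ᶠ h in 𝓝 (0 : Fin 4 → ℝ), gDen (a + h) ≠ 0 :=
    hcont.eventually_ne (by simpa using ha)
  have hinv : (fun h => (gDen (a + h))⁻¹) =O[𝓝 0] fun _ => (1 : ℝ) :=
    (hcont.inv₀ (by simpa using ha)).tendsto.isBigO_one ℝ
  have hn0 : (fun h : Fin 4 → ℝ => ‖h‖) =o[𝓝 0] fun _ => (1 : ℝ) := by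
    rw [Asymptotics.isLittleO_one_iff]
    exact tendsto_norm_zero
  have hn1 := hn0.isBigO
  have hmain : (fun h => (h 0 * h 1 * gLin a h + h 0 * h 1 * gQuad a h
      - gDenLin a h * gQuad a h) * (gDen (a + h))⁻¹) =O[𝓝 0] fun h => ‖h‖ * ‖h‖ * ‖h‖ := by
    have t1 := h01.mul hl
    -- This term has order four; weakening `gQuad` to `O(‖h‖)` brings it to the common cubic bound.
    have t2 : (fun h => h 0 * h 1 * gQuad a h) =O[𝓝 0] fun h => ‖h‖ * ‖h‖ * ‖h‖ := by
      have h2 : (fun h => gQuad a h) =O[𝓝 0] fun h => ‖h‖ :=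
        hQ.trans (by simpa using hn1.mul (Asymptotics.isBigO_refl (fun h : Fin 4 → ℝ => ‖h‖) _))
      exact h01.mul h2
    have t3 : (fun h => gDenLin a h * gQuad a h) =O[𝓝 0] fun h => ‖h‖ * ‖h‖ * ‖h‖ := by
      simpa [mul_assoc] using hq.mul hQ
    simpa using ((t1.add t2).sub t3).mul hinv
  have hres : (fun h : Fin 4 → ℝ => ‖h‖ * ‖h‖ * ‖h‖) =o[𝓝 0] fun h => ‖h‖ ^ 2 := by
    have := (Asymptotics.isBigO_refl (fun h : Fin 4 → ℝ => ‖h‖ * ‖h‖) (𝓝 0)).mul_isLittleO hn0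
    simpa [pow_two] using this
  refine (hmain.trans_isLittleO hres).congr' ?_ .rfl
  filter_upwards [hne] with h hh
  exact (gNu_add_sub ha hh).symm

/-! ### Coefficients of the two Taylor forms -/

/-- The coefficients of the linear form `gLin a`. -/
noncomputable def gCoef (a : Fin 4 → ℝ) : Fin 4 → ℝ :=
  ![(a 3 - a 2 + gNu a * a 1) / gDen a, gNu a * a 0 / gDen a, (-a 0 - gNu a) / gDen a,
    a 0 / gDen a]

/-- The coefficients of the quadratic form `gQuad a`. -/
noncomputable def gQuadCoef (a : Fin 4 → ℝ) (i j : Fin 4) : ℝ :=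
  ((![1, 0, 0, 0] : Fin 4 → ℝ) i * (![0, gNu a, -1, 1] : Fin 4 → ℝ) j
    - gCoef a i * (![-a 1, -a 0, 1, 0] : Fin 4 → ℝ) j) / gDen a

lemma gLin_eq_sum (a h : Fin 4 → ℝ) : gLin a h = ∑ i, gCoef a i * h i := by
  simp [gLin, gCoef, gDenLin, Fin.sum_univ_four]
  ring

lemma gQuad_eq_sum (a h : Fin 4 → ℝ) :
    gQuad a h = ∑ i, ∑ j, gQuadCoef a i j * (h i * h j) := by
  rw [gQuad, gLin_eq_sum]
  simp [gQuadCoef, gDenLin, Fin.sum_univ_four]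
  ring

/-- The vector `(X, f(X+1), X f(X), X f(X+1))`. -/
noncomputable def zVec (f : ℕ → ℝ) : Fin 4 → ℕ → ℝ :=
  ![fun y => (y : ℝ), fun y => f (y + 1), fun y => (y : ℝ) * f y, fun y => (y : ℝ) * f (y + 1)]

lemma zBar_apply (f : ℕ → ℝ) (n : ℕ) (x : ℕ → ℕ) (i : Fin 4) :
    zBar f n x i = sampleMean n x (zVec f i) := by
  fin_cases i <;> rfl

lemma steinEstimator_eq_gNu (f : ℕ → ℝ) (n : ℕ) (x : ℕ → ℕ) :
    steinEstimator f n x = gNu (zBar f n x) := by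
  simp only [steinEstimator, gNu, zBar_apply, zVec, sampleMean]
  simp [mul_sub, Finset.sum_sub_distrib]

/-! ### Moments of `Z` and the closed formulas -/

section Moments

variable {ν μ : ℝ} {f : ℕ → ℝ}

lemma memLp_zVec (hν : 0 < ν) (hμ : 0 < μ)
    (hf1 : Integrable (fun x : ℕ => f (x + 1) ^ 2) (nbLaw ν μ))
    (hf2 : Integrable (fun x : ℕ => ((x : ℝ) * f x) ^ 2) (nbLaw ν μ))
    (hf3 : Integrable (fun x : ℕ => ((x : ℝ) * f (x + 1)) ^ 2) (nbLaw ν μ)) (i : Fin 4) :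
    MemLp (zVec f i) 2 (nbLaw ν μ) := by
  fin_cases i
  · exact memLp_natCast_nbLaw hν hμ
  · exact (memLp_two_iff_integrable_sq (by fun_prop)).2 hf1
  · exact (memLp_two_iff_integrable_sq (by fun_prop)).2 hf2
  · exact (memLp_two_iff_integrable_sq (by fun_prop)).2 hf3

lemma gDen_zMean : gDen (zMean ν μ f) = eta ν μ f := by
  simp [gDen, zMean, eta]

/-- The second moments of `(X, f(X+1), X f(X), X f(X+1))`. -/
noncomputable def zSecond (ν μ : ℝ) (f : ℕ → ℝ) : Fin 4 → Fin 4 → ℝ :=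
  let m := mom ν μ f
  ![![sigmaSq ν μ + μ ^ 2, m 1 0 1, m 2 1 0, m 2 0 1], ![m 1 0 1, m 0 0 2, m 1 1 1, m 1 0 2],
    ![m 2 1 0, m 1 1 1, m 2 2 0, m 2 1 1], ![m 2 0 1, m 1 0 2, m 2 1 1, m 2 0 2]]

/-- The right side is `D Σ Dᵀ / n`. Here `g(μ_Z)` is unfolded to a quotient of moments instead of
being replaced by `ν`, because the stated formula does not contain `ν` explicitly. -/
lemma asympVar_eq (heta : eta ν μ f ≠ 0) (n : ℕ) :
    asympVar ν μ f n = (∑ i, ∑ j, gCoef (zMean ν μ f) i * gCoef (zMean ν μ f) j *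
      (zSecond ν μ f i j - zMean ν μ f i * zMean ν μ f j)) / n := by
  simp only [Fin.sum_univ_four, gCoef, gDen_zMean, gNu]
  simp only [zSecond, zMean, asympVar, Matrix.cons_val]
  have he : eta ν μ f = mom ν μ f 1 1 0 - μ * mom ν μ f 0 0 1 := rfl
  rw [← he, one_div, mul_inv, mul_comm (_⁻¹) ((n : ℝ)⁻¹), mul_assoc, mul_comm (n : ℝ)⁻¹,
    div_eq_mul_inv]
  congr 1
  generalize mom ν μ f = m at *
  -- `η₁` stays a nonzero atom while denominators are cleared and is expanded only for `ring`.
  generalize eta ν μ f = e at *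
  field_simp
  subst he
  ring

/-- The matrix `gQuadCoef` is not symmetric; this is harmless, since only its quadratic form and its
pairing with the symmetric covariance matrix occur. -/
lemma asympBias_eq (heta : eta ν μ f ≠ 0) (n : ℕ) :
    asympBias ν μ f n = (∑ i, ∑ j, gQuadCoef (zMean ν μ f) i j *
      (zSecond ν μ f i j - zMean ν μ f i * zMean ν μ f j)) / n := by
  simp only [Fin.sum_univ_four, gQuadCoef, gCoef, gDen_zMean, gNu]
  simp only [zSecond, zMean, asympBias, Matrix.cons_val]
  have he : eta ν μ f = mom ν μ f 1 1 0 - μ * mom ν μ f 0 0 1 := rfl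
  rw [← he, one_div, mul_inv, mul_comm (_⁻¹) ((n : ℝ)⁻¹), neg_mul, mul_assoc, mul_comm (n : ℝ)⁻¹,
    div_eq_mul_inv, ← neg_mul]
  congr 1
  generalize mom ν μ f = m at *
  generalize eta ν μ f = e at *
  field_simp
  subst he
  ring

variable [IsProbabilityMeasure (nbLaw ν μ)]

lemma zMean_apply (hν : 0 < ν) (hμ : 0 < μ) (i : Fin 4) :
    zMean ν μ f i = ∫ x, zVec f i x ∂nbLaw ν μ := by
  fin_cases i
  · exact (integral_natCast_nbLaw hν hμ).symm
  all_goals simp [zMean, zVec, mom]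

/-- The Stein identity for `f` rearranges to `ν η₁ = μ (μ̃₁₀₁ - μ̃₁₁₀)`. -/
lemma gNu_zMean (hν : 0 < ν) (hμ : 0 < μ) (hZ : ∀ i, MemLp (zVec f i) 2 (nbLaw ν μ))
    (heta : eta ν μ f ≠ 0) : gNu (zMean ν μ f) = ν := by
  have hI := fun i => (hZ i).integrable (by norm_num)
  have h := stein_identity hν hμ (h := f) (hI 1) (hI 2) (hI 3)
  have h1 : mom ν μ f 0 0 1 = ∫ x, f (x + 1) ∂nbLaw ν μ := by simp [mom]
  have h2 : mom ν μ f 1 1 0 = ∫ x : ℕ, (x : ℝ) * f x ∂nbLaw ν μ := by simp [mom]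
  have h3 : mom ν μ f 1 0 1 = ∫ x : ℕ, (x : ℝ) * f (x + 1) ∂nbLaw ν μ := by simp [mom]
  rw [← h1, ← h2, ← h3] at h
  have hd : gNu (zMean ν μ f) =
      μ * (mom ν μ f 1 0 1 - mom ν μ f 1 1 0) / eta ν μ f := by
    simp [gNu, zMean, eta]
  rw [hd, div_eq_iff heta, eta]
  linarith

lemma covariance_zVec (hν : 0 < ν) (hμ : 0 < μ) (hZ : ∀ i, MemLp (zVec f i) 2 (nbLaw ν μ))
    (i j : Fin 4) : covariance (zVec f i) (zVec f j) (nbLaw ν μ) =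
      zSecond ν μ f i j - zMean ν μ f i * zMean ν μ f j := by
  rw [covariance_eq_sub (hZ i) (hZ j), zMean_apply hν hμ i, zMean_apply hν hμ j]
  congr 1
  -- The only entry of `zSecond` that is expressed through the variance rather than a mixed moment.
  have h00 : ∫ x : ℕ, (x : ℝ) * x ∂nbLaw ν μ = sigmaSq ν μ + μ ^ 2 := by
    rw [sigmaSq, variance_eq_sub (memLp_natCast_nbLaw hν hμ), integral_natCast_nbLaw hν hμ]
    simp [pow_two]
  fin_cases i <;> fin_cases j <;>
    first
    | exact h00
    | (simp only [zSecond, zVec, mom]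
       exact integral_congr_ae (.of_forall fun x => by simp; try ring))

end Moments

/-! ### Asymptotic normality, Taylor remainder and bias -/

section Asymptotics

variable {Ω : Type*} [MeasurableSpace Ω] {P : Measure Ω}
  {ν μ : ℝ} {f : ℕ → ℝ} {X : ℕ → Ω → ℕ}

lemma aemeasurable_zBar (hlaw : ∀ i, HasLaw (X i) (nbLaw ν μ) P)
    (hZ : ∀ i, MemLp (zVec f i) 2 (nbLaw ν μ)) (n : ℕ) :
    AEMeasurable (fun ω => zBar f n fun k => X k ω) P := by
  refine aemeasurable_pi_lambda _ fun i => ?_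
  simp only [zBar_apply]
  exact (memLp_sampleMean hlaw (hZ i) n).1.aemeasurable

lemma memLp_linearCombination_zVec (hZ : ∀ i, MemLp (zVec f i) 2 (nbLaw ν μ)) (c : Fin 4 → ℝ) :
    MemLp (fun y => ∑ i, c i * zVec f i y) 2 (nbLaw ν μ) :=
  memLp_finsetSum _ fun i _ => (hZ i).const_mul (c i)

variable [IsProbabilityMeasure P] [IsProbabilityMeasure (nbLaw ν μ)]

lemma zBar_sub_zMean_apply (hν : 0 < ν) (hμ : 0 < μ) (n : ℕ) (x : ℕ → ℕ) (i : Fin 4) :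
    (zBar f n x - zMean ν μ f) i = sampleMean n x (zVec f i) - ∫ y, zVec f i y ∂nbLaw ν μ := by
  rw [Pi.sub_apply, zBar_apply, zMean_apply hν hμ]

lemma memLp_zBar_sub_zMean (hν : 0 < ν) (hμ : 0 < μ) (hlaw : ∀ i, HasLaw (X i) (nbLaw ν μ) P)
    (hZ : ∀ i, MemLp (zVec f i) 2 (nbLaw ν μ)) (n : ℕ) (i : Fin 4) :
    MemLp (fun ω => (zBar f n (fun k => X k ω) - zMean ν μ f) i) 2 P := by
  simp only [zBar_sub_zMean_apply hν hμ]
  exact (memLp_sampleMean hlaw (hZ i) n).sub (memLp_const _)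

lemma integrable_zBar_sub_mul (hν : 0 < ν) (hμ : 0 < μ)
    (hlaw : ∀ i, HasLaw (X i) (nbLaw ν μ) P)
    (hZ : ∀ i, MemLp (zVec f i) 2 (nbLaw ν μ)) (n : ℕ) (i j : Fin 4) :
    Integrable (fun ω => (zBar f n (fun k => X k ω) - zMean ν μ f) i *
      (zBar f n (fun k => X k ω) - zMean ν μ f) j) P :=
  (memLp_zBar_sub_zMean hν hμ hlaw hZ n i).integrable_mul
    (memLp_zBar_sub_zMean hν hμ hlaw hZ n j)

lemma integral_zBar_sub_mul (hν : 0 < ν) (hμ : 0 < μ) (hlaw : ∀ i, HasLaw (X i) (nbLaw ν μ) P)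
    (hindep : iIndepFun X P) (hZ : ∀ i, MemLp (zVec f i) 2 (nbLaw ν μ)) {n : ℕ} (hn : 1 ≤ n)
    (i j : Fin 4) :
    ∫ ω, (zBar f n (fun k => X k ω) - zMean ν μ f) i *
      (zBar f n (fun k => X k ω) - zMean ν μ f) j ∂P =
      covariance (zVec f i) (zVec f j) (nbLaw ν μ) / n := by
  simp only [zBar_sub_zMean_apply hν hμ]
  exact integral_sampleMean_sub_mul_sub hlaw hindep (hZ i) (hZ j) hn

/-- The norm is the supremum norm; the bound reduces its second moment to coordinate variances. -/
lemma norm_sq_le_sum_sq (h : Fin 4 → ℝ) : ‖h‖ ^ 2 ≤ ∑ i, h i * h i := by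
  rw [← Real.le_sqrt (norm_nonneg _) (Finset.sum_nonneg fun i _ => mul_self_nonneg _),
    pi_norm_le_iff_of_nonneg (Real.sqrt_nonneg _)]
  refine fun i => Real.le_sqrt_of_sq_le ?_
  rw [Real.norm_eq_abs, sq_abs, pow_two]
  exact Finset.single_le_sum (f := fun i => h i * h i) (fun j _ => mul_self_nonneg _)
    (Finset.mem_univ i)

lemma integrable_norm_sq_zBar_sub (hν : 0 < ν) (hμ : 0 < μ)
    (hlaw : ∀ i, HasLaw (X i) (nbLaw ν μ) P)
    (hZ : ∀ i, MemLp (zVec f i) 2 (nbLaw ν μ)) (n : ℕ) :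
    Integrable (fun ω => ‖zBar f n (fun k => X k ω) - zMean ν μ f‖ ^ 2) P := by
  have hW := fun i => integrable_zBar_sub_mul hν hμ hlaw hZ n i i
  refine Integrable.mono' (integrable_finsetSum Finset.univ fun i _ => hW i)
    (((aemeasurable_zBar hlaw hZ n).sub_const _).norm.pow_const 2).aestronglyMeasurable
    (.of_forall fun ω => ?_)
  rw [Real.norm_of_nonneg (by positivity)]
  simpa using norm_sq_le_sum_sq (zBar f n (fun k => X k ω) - zMean ν μ f)

lemma mul_integral_norm_sq_zBar_sub_le (hν : 0 < ν) (hμ : 0 < μ)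
    (hlaw : ∀ i, HasLaw (X i) (nbLaw ν μ) P) (hindep : iIndepFun X P)
    (hZ : ∀ i, MemLp (zVec f i) 2 (nbLaw ν μ)) (n : ℕ) :
    (n : ℝ) * ∫ ω, ‖zBar f n (fun k => X k ω) - zMean ν μ f‖ ^ 2 ∂P ≤
      ∑ i, covariance (zVec f i) (zVec f i) (nbLaw ν μ) := by
  have hnn : ∀ i, 0 ≤ covariance (zVec f i) (zVec f i) (nbLaw ν μ) := fun i => by
    rw [covariance_self (by fun_prop)]; exact variance_nonneg _ _
  rcases Nat.eq_zero_or_pos n with rfl | hn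
  · simpa using Finset.sum_nonneg fun i _ => hnn i
  have hW := fun i => integrable_zBar_sub_mul hν hμ hlaw hZ n i i
  have hn' : (0 : ℝ) < n := by positivity
  have h1 : ∫ ω, ‖zBar f n (fun k => X k ω) - zMean ν μ f‖ ^ 2 ∂P ≤
      ∑ i, covariance (zVec f i) (zVec f i) (nbLaw ν μ) / n := by
    simp only [← integral_zBar_sub_mul hν hμ hlaw hindep hZ hn]
    rw [← integral_finsetSum _ fun i _ => hW i]
    exact integral_mono (integrable_norm_sq_zBar_sub hν hμ hlaw hZ n)
      (integrable_finsetSum Finset.univ fun i _ => hW i)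
      fun ω => norm_sq_le_sum_sq _
  rw [← Finset.sum_div, le_div_iff₀ hn'] at h1
  linarith

/-- The linear form `gLin` applied to the error of `zBar` is the error of a sample mean. -/
lemma gLin_zBar_sub (hν : 0 < ν) (hμ : 0 < μ) (hZ : ∀ i, MemLp (zVec f i) 2 (nbLaw ν μ))
    (a : Fin 4 → ℝ) (n : ℕ) (x : ℕ → ℕ) :
    gLin a (zBar f n x - zMean ν μ f) =
      sampleMean n x (fun y => ∑ i, gCoef a i * zVec f i y) -
        ∫ y, ∑ i, gCoef a i * zVec f i y ∂nbLaw ν μ := by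
  rw [gLin_eq_sum, integral_finsetSum _ fun i _ =>
    ((hZ i).integrable (by norm_num)).const_mul _]
  simp only [zBar_sub_zMean_apply hν hμ, mul_sub, integral_const_mul, Finset.sum_sub_distrib]
  congr 1
  simp only [sampleMean]
  rw [Finset.sum_comm, Finset.mul_sum]
  refine Finset.sum_congr rfl fun i _ => ?_
  rw [← Finset.mul_sum]
  ring

lemma covariance_linearCombination_zVec (hZ : ∀ i, MemLp (zVec f i) 2 (nbLaw ν μ))
    (c : Fin 4 → ℝ) :
    covariance (fun y => ∑ i, c i * zVec f i y) (fun y => ∑ i, c i * zVec f i y) (nbLaw ν μ) =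
      ∑ i, ∑ j, c i * c j * covariance (zVec f i) (zVec f j) (nbLaw ν μ) := by
  rw [covariance_fun_sum_fun_sum (fun i => (hZ i).const_mul (c i))
    fun i => (hZ i).const_mul (c i)]
  simp only [covariance_const_mul_left, covariance_const_mul_right, mul_assoc, mul_left_comm]

/-- `gLin` of the error is the centred sample mean of one scalar function, so no multivariate limit
theorem is needed; Slutsky's theorem absorbs the first-order remainder. -/
lemma tendstoInDistribution_steinEstimator (hν : 0 < ν) (hμ : 0 < μ)
    (hlaw : ∀ i, HasLaw (X i) (nbLaw ν μ) P) (hindep : iIndepFun X P)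
    (hZ : ∀ i, MemLp (zVec f i) 2 (nbLaw ν μ)) (heta : eta ν μ f ≠ 0) :
    TendstoInDistribution
      (fun (n : ℕ) ω => √n * (steinEstimator f n (fun i => X i ω) - ν)) atTop id (fun _ => P)
      (gaussianReal 0 (∑ i, ∑ j, gCoef (zMean ν μ f) i * gCoef (zMean ν μ f) j *
        covariance (zVec f i) (zVec f j) (nbLaw ν μ)).toNNReal) := by
  have ha : gDen (zMean ν μ f) ≠ 0 := by rwa [gDen_zMean]
  have hclt := tendstoInDistribution_sqrt_mul_sampleMean_sub hlaw hindep
    (memLp_linearCombination_zVec hZ (gCoef (zMean ν μ f)))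
  rw [covariance_linearCombination_zVec hZ] at hclt
  simp only [← gLin_zBar_sub hν hμ hZ] at hclt
  have ho : (fun h => gNu (zMean ν μ f + h) - gNu (zMean ν μ f) - gLin (zMean ν μ f) h)
      =o[𝓝 0] fun h => ‖h‖ ^ 1 := by
    have := hasFDerivAt_iff_isLittleO_nhds_zero.1
      ((contDiffAt_gNu ha).differentiableAt (by simp)).hasFDerivAt
    simpa only [fderiv_gNu ha, pow_one] using this.norm_right
  have hrem := tendstoInMeasure_sqrt_pow_mul_of_isLittleO
    (integrable_norm_sq_zBar_sub hν hμ hlaw hZ)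
    (mul_integral_norm_sq_zBar_sub_le hν hμ hlaw hindep hZ) ho
  refine tendstoInDistribution_of_tendstoInMeasure_sub _ id hclt ?_ fun n => ?_
  · refine hrem.congr_left fun n => .of_forall fun ω => ?_
    simp only [add_sub_cancel, gNu_zMean hν hμ hZ heta, steinEstimator_eq_gNu, pow_one,
      Pi.sub_apply]
    ring
  · simp only [steinEstimator_eq_gNu]
    have hg : Measurable gNu := by unfold gNu; fun_prop
    exact ((hg.comp_aemeasurable (aemeasurable_zBar hlaw hZ n)).sub_const ν).const_mul _

lemma tendstoInMeasure_taylorTwo_remainder (hν : 0 < ν) (hμ : 0 < μ)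
    (hlaw : ∀ i, HasLaw (X i) (nbLaw ν μ) P) (hindep : iIndepFun X P)
    (hZ : ∀ i, MemLp (zVec f i) 2 (nbLaw ν μ)) (heta : eta ν μ f ≠ 0) :
    TendstoInMeasure P
      (fun (n : ℕ) ω => (n : ℝ) * (steinEstimator f n (fun i => X i ω) - ν -
        taylorTwo gNu (zMean ν μ f) (zBar f n (fun i => X i ω)))) atTop fun _ => 0 := by
  have ha : gDen (zMean ν μ f) ≠ 0 := by rwa [gDen_zMean]
  refine (tendstoInMeasure_sqrt_pow_mul_of_isLittleO
    (integrable_norm_sq_zBar_sub hν hμ hlaw hZ)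
    (mul_integral_norm_sq_zBar_sub_le hν hμ hlaw hindep hZ)
    (gNu_taylor_isLittleO ha)).congr_left fun n => .of_forall fun ω => ?_
  simp only [add_sub_cancel, gNu_zMean hν hμ hZ heta, steinEstimator_eq_gNu, taylorTwo_gNu ha]
  rw [Real.sq_sqrt (by positivity)]

/-- The linear term is centred, and each product of errors in the quadratic term has mean equal to a
covariance over `n`; hence the identity is exact for every `n ≥ 1`. -/
lemma integral_taylorTwo (hν : 0 < ν) (hμ : 0 < μ)
    (hlaw : ∀ i, HasLaw (X i) (nbLaw ν μ) P) (hindep : iIndepFun X P)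
    (hZ : ∀ i, MemLp (zVec f i) 2 (nbLaw ν μ)) (heta : eta ν μ f ≠ 0) {n : ℕ} (hn : 1 ≤ n) :
    Integrable (fun ω => taylorTwo gNu (zMean ν μ f) (zBar f n (fun i => X i ω))) P ∧
      ∫ ω, taylorTwo gNu (zMean ν μ f) (zBar f n (fun i => X i ω)) ∂P = asympBias ν μ f n := by
  have ha : gDen (zMean ν μ f) ≠ 0 := by rwa [gDen_zMean]
  simp only [taylorTwo_gNu ha]
  have hφ := memLp_linearCombination_zVec hZ (gCoef (zMean ν μ f))
  have hS := (memLp_sampleMean hlaw hφ n).integrable (by norm_num)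
  have hl : Integrable (fun ω => gLin (zMean ν μ f)
      (zBar f n (fun i => X i ω) - zMean ν μ f)) P := by
    simp only [gLin_zBar_sub hν hμ hZ]
    exact hS.sub (integrable_const _)
  have hl0 : ∫ ω, gLin (zMean ν μ f) (zBar f n (fun i => X i ω) - zMean ν μ f) ∂P = 0 := by
    simp only [gLin_zBar_sub hν hμ hZ]
    rw [integral_sub hS (integrable_const _), integral_sampleMean hlaw hφ hn]
    simp
  have hij := fun i j => (integrable_zBar_sub_mul hν hμ hlaw hZ n i j).const_mul
    (gQuadCoef (zMean ν μ f) i j)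
  have hq : Integrable (fun ω => gQuad (zMean ν μ f)
      (zBar f n (fun i => X i ω) - zMean ν μ f)) P := by
    simp only [gQuad_eq_sum]
    exact integrable_finsetSum _ fun i _ => integrable_finsetSum _ fun j _ => hij i j
  refine ⟨hl.add hq, ?_⟩
  rw [integral_add hl hq, hl0, zero_add, asympBias_eq heta]
  simp only [gQuad_eq_sum]
  rw [integral_finsetSum _ fun i _ => integrable_finsetSum _ fun j _ => hij i j, Finset.sum_div]
  refine Finset.sum_congr rfl fun i _ => ?_
  rw [integral_finsetSum _ fun j _ => hij i j, Finset.sum_div]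
  refine Finset.sum_congr rfl fun j _ => ?_
  rw [integral_const_mul, integral_zBar_sub_mul hν hμ hlaw hindep hZ hn,
    covariance_zVec hν hμ hZ, mul_div_assoc]

end Asymptotics

end SteinNB

theorem mainTheorem2 {Ω : Type*} [MeasurableSpace Ω] (P : Measure Ω) [IsProbabilityMeasure P]
    (ν μ : ℝ) (hν : 0 < ν) (hμ : 0 < μ) (f : ℕ → ℝ)
    (X : ℕ → Ω → ℕ)
    (hlaw : ∀ i, HasLaw (X i) (SteinNB.nbLaw ν μ) P)
    (hindep : iIndepFun X P)
    (hf1 : Integrable (fun x : ℕ => f (x + 1) ^ 2) (SteinNB.nbLaw ν μ))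
    (hf2 : Integrable (fun x : ℕ => ((x : ℝ) * f x) ^ 2) (SteinNB.nbLaw ν μ))
    (hf3 : Integrable (fun x : ℕ => ((x : ℝ) * f (x + 1)) ^ 2) (SteinNB.nbLaw ν μ))
    (heta : SteinNB.eta ν μ f ≠ 0) :
    -- asymptotic normality, with asymptotic variance `asympVar`
    (∃ V : NNReal,
      (∀ n : ℕ, 1 ≤ n → SteinNB.asympVar ν μ f n = (V : ℝ) / n) ∧
      TendstoInDistribution
        (fun (n : ℕ) ω =>
          Real.sqrt n * (SteinNB.steinEstimator f n (fun i => X i ω) - ν))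
        atTop id (fun _ => P) (gaussianReal 0 V)) ∧
    -- the second-order Taylor approximation of the estimation error is exact up to `o_P(1/n)`
    TendstoInMeasure P
      (fun (n : ℕ) ω =>
        (n : ℝ) * (SteinNB.steinEstimator f n (fun i => X i ω) - ν -
          SteinNB.taylorTwo SteinNB.gNu (SteinNB.zMean ν μ f)
            (SteinNB.zBar f n (fun i => X i ω))))
      atTop (fun _ => 0) ∧
    -- and its expectation, the asymptotic bias, is `asympBias`
    (∀ n : ℕ, 1 ≤ n →
      Integrable (fun ω => SteinNB.taylorTwo SteinNB.gNu (SteinNB.zMean ν μ f)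
        (SteinNB.zBar f n (fun i => X i ω))) P ∧
      ∫ ω, SteinNB.taylorTwo SteinNB.gNu (SteinNB.zMean ν μ f)
        (SteinNB.zBar f n (fun i => X i ω)) ∂P = SteinNB.asympBias ν μ f n) := by
  -- The law inherits total mass one from `P` through `X 0`, so the weights need not be summed.
  have : IsProbabilityMeasure (SteinNB.nbLaw ν μ) :=
    (hlaw 0).isProbabilityMeasure_iff.1 inferInstance
  have hZ := SteinNB.memLp_zVec hν hμ hf1 hf2 hf3
  refine ⟨⟨_, fun n _ => ?_,
    SteinNB.tendstoInDistribution_steinEstimator hν hμ hlaw hindep hZ heta⟩,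
    SteinNB.tendstoInMeasure_taylorTwo_remainder hν hμ hlaw hindep hZ heta,
    fun n hn => SteinNB.integral_taylorTwo hν hμ hlaw hindep hZ heta hn⟩
  rw [SteinNB.asympVar_eq heta, Real.coe_toNNReal]
  · simp only [SteinNB.covariance_zVec hν hμ hZ]
  -- The quadratic form is the variance of a linear combination, so truncation to `NNReal` leaves it
  -- unchanged.
  · rw [← SteinNB.covariance_linearCombination_zVec hZ, covariance_self (by fun_prop)]
    exact variance_nonneg _ _
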